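/- Let $A$ be a real $n\times n$ matrix, and consider the linear time-invariant system $\dot r(t)=Ar(t)$, $r(t)\in\mathbb{R}^n$. For a solution $r$, let $\kappa(t)$ denote the first curvature of the trajectory $r(t)$, that is, $\kappa(t)=\left\|\frac{d}{ds}\frac{\dot r(t)}{\|\dot r(t)\|}\right\|$ with $ds=\|\dot r(t)\|\,dt$ (Euclidean norms; $\kappa\equiv 0$ if $r$ is constant). Suppose that $A$ is invertible and that all complex eigenvalues of $A$ are real. If there exists a Lebesgue measurable set $E\subseteq\mathbb{R}^n$ of positive Lebesgue measure such that, for every solution $r$ with $r(0)\in E$, either $\lim_{t\to+\infty}\kappa(t)\neq 0$ (the value $+\infty$ is allowed) or $\lim_{t\to+\infty}\kappa(t)$ does not exist, then the zero solution of the system is asymptotically stable: for every $\varepsilon>0$ there is $\delta>0$ such that every solution with $\|r(0)\|<\delta$ satisfies $\|r(t)\|<\varepsilon$ for all $t\ge 0$, and there is $\delta_1>0$ such that every solution with $\|r(0)\|<\delta_1$ satisfies $\lim_{t\to+\infty}r(t)=0$. -/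

import Mathlib

open Filter Topology MeasureTheory

noncomputable section

namespace LTISystem

/-- `r` solves the linear time-invariant system `r'(t) = A r(t)`. The norm on
`EuclideanSpace ℝ (Fin n)` is the Euclidean norm. -/
def IsSolution {n : ℕ} (A : Matrix (Fin n) (Fin n) ℝ) (r : ℝ → EuclideanSpace ℝ (Fin n)) : Prop :=
  ∀ t : ℝ, HasDerivAt r (Matrix.toEuclideanCLM (n := Fin n) (𝕜 := ℝ) A (r t)) t

/-- The zero solution of `r' = A r` is stable. -/
def IsStable {n : ℕ} (A : Matrix (Fin n) (Fin n) ℝ) : Prop :=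
  ∀ ε : ℝ, 0 < ε → ∃ δ : ℝ, 0 < δ ∧
    ∀ r : ℝ → EuclideanSpace ℝ (Fin n), IsSolution A r → ‖r 0‖ < δ →
      ∀ t : ℝ, 0 ≤ t → ‖r t‖ < ε

/-- The zero solution of `r' = A r` is asymptotically stable: it is stable, and all solutions that
start close enough to `0` tend to `0`. -/
def IsAsymptoticallyStable {n : ℕ} (A : Matrix (Fin n) (Fin n) ℝ) : Prop :=
  IsStable A ∧ ∃ δ : ℝ, 0 < δ ∧
    ∀ r : ℝ → EuclideanSpace ℝ (Fin n), IsSolution A r → ‖r 0‖ < δ →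
      Tendsto r atTop (𝓝 0)

/-- The unit tangent vector `r'(t) / ‖r'(t)‖` of a curve. -/
def unitTangent {n : ℕ} (r : ℝ → EuclideanSpace ℝ (Fin n)) (t : ℝ) : EuclideanSpace ℝ (Fin n) :=
  ‖deriv r t‖⁻¹ • deriv r t

/-- The first curvature `κ(t)` of a curve: the norm of the derivative of the unit tangent vector
with respect to arc length `s`, where `ds = ‖r'(t)‖ dt`. For a constant curve this is `0`. -/
def firstCurvature {n : ℕ} (r : ℝ → EuclideanSpace ℝ (Fin n)) (t : ℝ) : ℝ :=
  ‖deriv (unitTangent r) t‖ / ‖deriv r t‖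

/-- All (complex) eigenvalues of the real matrix `A` are real numbers. -/
def HasOnlyRealEigenvalues {n : ℕ} (A : Matrix (Fin n) (Fin n) ℝ) : Prop :=
  ∀ z : ℂ, Module.End.HasEigenvalue (Matrix.toLin' (A.map (algebraMap ℝ ℂ))) z → z.im = 0

end LTISystem

end

/-! A left eigenvector `w` for an eigenvalue `l > 0` gives `⟪w, r t⟫ = exp (l t) ⟪w, r 0⟫`, so off
the null hyperplane orthogonal to `w` the speed blows up. Curvature is at most `2‖A‖` divided by the
speed, hence tends to `0`. A set of positive measure leaves the hyperplane, so no eigenvalue is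
positive; invertibility excludes `0`.

With all eigenvalues negative, Cayley–Hamilton makes `charpoly(A)` annihilate every solution.
Removing its linear factors one at a time (`DecaysAlong.of_mul_X_sub_C`) yields exponential decay
without Jordan form. -/

namespace LTISystem

open Polynomial Module

section Decay

variable {E : Type*} [NormedAddCommGroup E] [NormedSpace ℝ E]

/-- A solution of `f' = l f + g` with `l < -m` decays like `exp (-m t)` if `g` does. -/
theorem norm_le_of_hasDerivAt_smul_add {f g : ℝ → E} {l m M : ℝ} (hm : l < -m)
    (hf : ∀ t, HasDerivAt f (l • f t + g t) t)
    (hg : ∀ t, 0 ≤ t → ‖g t‖ ≤ M * Real.exp (-m * t)) {t : ℝ} (ht : 0 ≤ t) :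
    ‖f t‖ ≤ (‖f 0‖ + M / (-m - l)) * Real.exp (-m * t) := by
  have hd : 0 < -m - l := by linarith
  have hM : 0 ≤ M := by simpa using (norm_nonneg _).trans (hg 0 le_rfl)
  have hexp : ∀ s, HasDerivAt (fun s : ℝ => Real.exp (-l * s)) (Real.exp (-l * s) * -l) s :=
    fun s => by simpa using ((hasDerivAt_id s).const_mul (-l)).exp
  -- The integrating factor `exp (-l s)` cancels the term `l • f`.
  have hh : ∀ s, HasDerivAt (fun s => Real.exp (-l * s) • f s) (Real.exp (-l * s) • g s) s := by
    intro s
    refine ((hexp s).smul (hf s)).congr_deriv ?_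
    module
  have hB : ∀ s, HasDerivAt (fun s => ‖f 0‖ + M / (-m - l) * Real.exp ((-m - l) * s))
      (M * Real.exp ((-m - l) * s)) s := by
    intro s
    have h1 : HasDerivAt (fun s : ℝ => Real.exp ((-m - l) * s))
        (Real.exp ((-m - l) * s) * (-m - l)) s := by
      simpa using ((hasDerivAt_id s).const_mul (-m - l)).exp
    refine ((h1.const_mul (M / (-m - l))).const_add ‖f 0‖).congr_deriv ?_
    field_simp
  have key := image_norm_le_of_norm_deriv_right_le_deriv_boundary (a := 0) (b := t)
    (fun s _ => (hh s).continuousAt.continuousWithinAt)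
    (fun s _ => (hh s).hasDerivWithinAt)
    (by simpa using div_nonneg hM hd.le) hB
    (fun s hs => by
      rw [norm_smul, Real.norm_eq_abs, Real.abs_exp]
      calc Real.exp (-l * s) * ‖g s‖ ≤ Real.exp (-l * s) * (M * Real.exp (-m * s)) := by
            gcongr
            exact hg s hs.1
        _ = M * Real.exp ((-m - l) * s) := by
            rw [mul_left_comm, ← Real.exp_add]
            ring_nf) (Set.right_mem_Icc.2 ht)
  rw [norm_smul, Real.norm_eq_abs, Real.abs_exp] at key
  have h1 : ‖f t‖ = Real.exp (l * t) * (Real.exp (-l * t) * ‖f t‖) := by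
    rw [← mul_assoc, ← Real.exp_add]
    simp
  have h2 : Real.exp (l * t) ≤ Real.exp (-m * t) :=
    Real.exp_le_exp.2 (mul_le_mul_of_nonneg_right hm.le ht)
  have h3 : Real.exp (l * t) * Real.exp ((-m - l) * t) = Real.exp (-m * t) := by
    rw [← Real.exp_add]
    ring_nf
  calc ‖f t‖ ≤ Real.exp (l * t) * (‖f 0‖ + M / (-m - l) * Real.exp ((-m - l) * t)) := by
        rw [h1]
        gcongr
    _ = Real.exp (l * t) * ‖f 0‖ + M / (-m - l) * Real.exp (-m * t) := by
        rw [← h3]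
        ring
    _ ≤ Real.exp (-m * t) * ‖f 0‖ + M / (-m - l) * Real.exp (-m * t) := by gcongr
    _ = _ := by ring

/-- Exponential decay of `q(T) r`, with rate `m` and uniformly over the solutions of `r' = T r`. -/
def DecaysAlong (T : E →L[ℝ] E) (m : ℝ) (q : ℝ[X]) : Prop :=
  ∃ C : ℝ, ∀ r : ℝ → E, (∀ t, HasDerivAt r (T (r t)) t) →
    ∀ t, 0 ≤ t → ‖aeval T q (r t)‖ ≤ C * ‖r 0‖ * Real.exp (-m * t)

/-- `f = q(T) r` satisfies `f' = l f + g` with `g = (q (X - l))(T) r` decaying. The strict gap `l <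
-m` keeps the rate `m` even for repeated roots. -/
theorem DecaysAlong.of_mul_X_sub_C {T : E →L[ℝ] E} {m l : ℝ} (hl : l < -m) {q : ℝ[X]}
    (h : DecaysAlong T m (q * (X - C l))) : DecaysAlong T m q := by
  obtain ⟨K, hK⟩ := h
  refine ⟨‖aeval T q‖ + K / (-m - l), fun r hr t ht => ?_⟩
  have hf : ∀ s, HasDerivAt (fun s => aeval T q (r s))
      (l • aeval T q (r s) + aeval T (q * (X - C l)) (r s)) s := by
    intro s
    refine ((aeval T q).hasFDerivAt.comp_hasDerivAt s (hr s)).congr_deriv ?_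
    simp [Algebra.algebraMap_eq_smul_one]
  refine (norm_le_of_hasDerivAt_smul_add hl hf (hK r hr) ht).trans ?_
  have h0 := (aeval T q).le_opNorm (r 0)
  calc _ ≤ (‖aeval T q‖ * ‖r 0‖ + K * ‖r 0‖ / (-m - l)) * Real.exp (-m * t) := by gcongr
    _ = _ := by ring

theorem DecaysAlong.of_mul_prod {T : E →L[ℝ] E} {m : ℝ} (s : Multiset ℝ)
    (hs : ∀ l ∈ s, l < -m) {q : ℝ[X]}
    (h : DecaysAlong T m (q * (s.map fun l => X - C l).prod)) : DecaysAlong T m q := by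
  induction s using Multiset.induction_on generalizing q with
  | empty => simpa using h
  | cons l s ih =>
    rw [Multiset.map_cons, Multiset.prod_cons, ← mul_assoc] at h
    exact (ih (fun a ha => hs a (Multiset.mem_cons_of_mem ha)) h).of_mul_X_sub_C
      (hs l (Multiset.mem_cons_self l s))

theorem exists_pos_forall_lt_neg (s : Multiset ℝ) (hs : ∀ l ∈ s, l < 0) :
    ∃ m : ℝ, 0 < m ∧ ∀ l ∈ s, l < -m := by
  induction s using Multiset.induction_on with
  | empty => exact ⟨1, one_pos, by simp⟩
  | cons a s ih =>
    obtain ⟨m, hm, h⟩ := ih fun l hl => hs l (Multiset.mem_cons_of_mem hl)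
    have ha := hs a (Multiset.mem_cons_self a s)
    refine ⟨min m (-a / 2), lt_min hm (by linarith), fun l hl => ?_⟩
    rcases Multiset.mem_cons.1 hl with rfl | hl
    · linarith [min_le_right m (-l / 2)]
    · linarith [h l hl, min_le_left m (-a / 2)]

end Decay

section Matrix

variable {n : ℕ} {A : Matrix (Fin n) (Fin n) ℝ}

theorem HasOnlyRealEigenvalues.splits_charpoly (h : HasOnlyRealEigenvalues A) :
    A.charpoly.Splits := by
  refine Splits.of_splits_map (algebraMap ℝ ℂ) (IsAlgClosed.splits _) fun z hz => ?_
  have hz' : IsRoot (Matrix.toLin' (A.map (algebraMap ℝ ℂ))).charpoly z := by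
    rw [Matrix.charpoly_toLin', Matrix.charpoly_map]
    exact isRoot_of_mem_roots hz
  have := h z ((End.hasEigenvalue_iff_isRoot_charpoly _ _).2 hz')
  exact ⟨z.re, Complex.ext (by simp) (by simp [this])⟩

/-- If the characteristic polynomial splits with negative roots, then all solutions decay
exponentially. -/
theorem exists_norm_le_exp_of_roots_neg (hsplit : A.charpoly.Splits)
    (hneg : ∀ l ∈ A.charpoly.roots, l < 0) :
    ∃ m : ℝ, 0 < m ∧ ∃ K : ℝ, ∀ r : ℝ → EuclideanSpace ℝ (Fin n), IsSolution A r →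
      ∀ t, 0 ≤ t → ‖r t‖ ≤ K * ‖r 0‖ * Real.exp (-m * t) := by
  obtain ⟨m, hm, hlt⟩ := exists_pos_forall_lt_neg _ hneg
  set T := Matrix.toEuclideanCLM (n := Fin n) (𝕜 := ℝ) A with hT
  have hCH : aeval T A.charpoly = 0 := by
    have := aeval_algHom_apply
      (Matrix.toEuclideanCLM (n := Fin n) (𝕜 := ℝ)).toAlgEquiv.toAlgHom A A.charpoly
    rw [Matrix.aeval_self_charpoly, map_zero] at this
    exact this
  have h1 : DecaysAlong T m (1 : ℝ[X]) := by
    refine DecaysAlong.of_mul_prod _ hlt ?_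
    rw [one_mul, ← hsplit.eq_prod_roots_of_monic A.charpoly_monic]
    exact ⟨0, fun r _ t _ => by simp [hCH]⟩
  obtain ⟨K, hK⟩ := h1
  exact ⟨m, hm, K, fun r hr t ht => by simpa using hK r hr t ht⟩

theorem isAsymptoticallyStable_of_roots_neg (hsplit : A.charpoly.Splits)
    (hneg : ∀ l ∈ A.charpoly.roots, l < 0) : IsAsymptoticallyStable A := by
  obtain ⟨m, hm, K, hK⟩ := exists_norm_le_exp_of_roots_neg hsplit hneg
  -- `K` may be negative or zero; `|K| + 1` is positive and bounds it.
  refine ⟨fun ε hε => ⟨ε / (|K| + 1), by positivity, fun r hr h0 t ht => ?_⟩,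
    1, one_pos, fun r hr _ => ?_⟩
  · have h1 : Real.exp (-m * t) ≤ 1 := Real.exp_le_one_iff.2 (by nlinarith)
    rw [lt_div_iff₀ (by positivity)] at h0
    calc ‖r t‖ ≤ K * ‖r 0‖ * Real.exp (-m * t) := hK r hr t ht
      _ ≤ (|K| + 1) * ‖r 0‖ * 1 := by
          gcongr
          linarith [le_abs_self K]
      _ < ε := by linarith
  · refine squeeze_zero_norm' (a := fun t => K * ‖r 0‖ * Real.exp (-m * t)) ?_ ?_
    · filter_upwards [eventually_ge_atTop 0] with t ht using hK r hr t ht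
    · have h : Tendsto (fun t : ℝ => Real.exp (-m * t)) atTop (𝓝 0) :=
        Real.tendsto_exp_atBot.comp (tendsto_id.const_mul_atTop_of_neg (neg_lt_zero.2 hm))
      simpa using h.const_mul (K * ‖r 0‖)

theorem exists_isSolution (A : Matrix (Fin n) (Fin n) ℝ) (x : EuclideanSpace ℝ (Fin n)) :
    ∃ r, IsSolution A r ∧ r 0 = x := by
  set T := Matrix.toEuclideanCLM (n := Fin n) (𝕜 := ℝ) A with hT
  refine ⟨fun t => NormedSpace.exp (t • T) x, fun t => ?_, ?_⟩
  · have h := (hasDerivAt_exp_smul_const' (𝕂 := ℝ) T t).clm_apply (hasDerivAt_const t x)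
    simpa using h
  · have h : NormedSpace.exp ((0 : ℝ) • T) = 1 :=
      (congrArg _ (zero_smul ℝ T)).trans NormedSpace.exp_zero
    exact congrArg (fun S : EuclideanSpace ℝ (Fin n) →L[ℝ] EuclideanSpace ℝ (Fin n) => S x) h

/-- Differentiating a normalized curve at most doubles the relative speed. -/
theorem norm_deriv_inv_norm_smul_le {E : Type*} [NormedAddCommGroup E] [InnerProductSpace ℝ E]
    {v : ℝ → E} {v' : E} {t : ℝ} (hv : HasDerivAt v v' t) (h0 : v t ≠ 0) :
    ‖deriv (fun s => ‖v s‖⁻¹ • v s) t‖ ≤ 2 * ‖v'‖ / ‖v t‖ := by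
  have hpos : 0 < ‖v t‖ := norm_pos_iff.2 h0
  have hN : HasDerivAt (fun s => ‖v s‖) (inner ℝ (v t) v' / ‖v t‖) t := by
    have h := hv.norm_sq.sqrt (by positivity)
    simp only [Real.sqrt_sq (norm_nonneg _)] at h
    refine h.congr_deriv ?_
    field_simp
  have hu := (hN.inv hpos.ne').smul hv
  have hu' : deriv (fun s => ‖v s‖⁻¹ • v s) t = _ := hu.deriv
  rw [hu']
  have hin : |inner ℝ (v t) v'| ≤ ‖v t‖ * ‖v'‖ := abs_real_inner_le_norm _ _
  refine (norm_add_le _ _).trans ?_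
  simp only [norm_smul, norm_div, norm_neg, Real.norm_eq_abs, abs_norm, norm_pow, norm_inv,
    Pi.inv_apply]
  calc _ ≤ ‖v t‖⁻¹ * ‖v'‖ + ‖v t‖ * ‖v'‖ / ‖v t‖ / ‖v t‖ ^ 2 * ‖v t‖ := by gcongr
    _ = _ := by
      field_simp
      ring

theorem IsSolution.firstCurvature_le {r : ℝ → EuclideanSpace ℝ (Fin n)} (hr : IsSolution A r)
    (t : ℝ) :
    firstCurvature r t ≤ 2 * ‖Matrix.toEuclideanCLM (n := Fin n) (𝕜 := ℝ) A‖ / ‖deriv r t‖ := by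
  set T := Matrix.toEuclideanCLM (n := Fin n) (𝕜 := ℝ) A with hT
  have hd : deriv r = fun s => T (r s) := funext fun s => (hr s).deriv
  rcases eq_or_ne (deriv r t) 0 with h0 | h0
  -- At zero velocity both sides are divisions by zero, hence `0`.
  · simp [firstCurvature, h0]
  have hv : HasDerivAt (deriv r) (T (deriv r t)) t := by
    have := T.hasFDerivAt.comp_hasDerivAt t (hr t)
    rw [hd]
    exact this
  have hpos : 0 < ‖deriv r t‖ := norm_pos_iff.2 h0
  unfold firstCurvature
  gcongr
  calc ‖deriv (unitTangent r) t‖ ≤ 2 * ‖T (deriv r t)‖ / ‖deriv r t‖ :=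
        norm_deriv_inv_norm_smul_le hv h0
    _ ≤ 2 * (‖T‖ * ‖deriv r t‖) / ‖deriv r t‖ := by
        gcongr
        exact T.le_opNorm _
    _ = 2 * ‖T‖ := by field_simp

theorem IsSolution.tendsto_firstCurvature_zero {r : ℝ → EuclideanSpace ℝ (Fin n)}
    (hr : IsSolution A r) (h : Tendsto (fun t => ‖deriv r t‖) atTop atTop) :
    Tendsto (firstCurvature r) atTop (𝓝 0) :=
  squeeze_zero (fun _ => div_nonneg (norm_nonneg _) (norm_nonneg _)) hr.firstCurvature_le
    (tendsto_const_nhds.div_atTop h)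

/-- Pairing with a left eigenvector reduces the system to a scalar equation. -/
theorem exists_left_eigenvector {l : ℝ} (hl : A.charpoly.IsRoot l) :
    ∃ w : EuclideanSpace ℝ (Fin n), w ≠ 0 ∧ ∀ x,
      inner ℝ w (Matrix.toEuclideanCLM (n := Fin n) (𝕜 := ℝ) A x) = l * inner ℝ w x := by
  have hdet : (Matrix.scalar (Fin n) l - A).det = 0 := by
    rw [← Matrix.eval_charpoly]
    exact hl
  obtain ⟨v, hv, hvA⟩ := Matrix.exists_vecMul_eq_zero_iff.2 hdet
  have hvA' : Matrix.vecMul v A = l • v := by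
    rw [Matrix.vecMul_sub, sub_eq_zero] at hvA
    rw [← hvA]
    ext i
    simp [Matrix.scalar_apply, Matrix.vecMul_diagonal, mul_comm]
  refine ⟨WithLp.toLp 2 v, by simpa using hv, fun x => ?_⟩
  rw [Matrix.inner_toEuclideanCLM, Matrix.dotProduct_mulVec]
  simp only [hvA', smul_dotProduct, EuclideanSpace.inner_eq_star_dotProduct]
  simp [dotProduct_comm]

/-- The component of the velocity along a left eigenvector of a positive eigenvalue blows up. -/
theorem IsSolution.tendsto_norm_deriv {r : ℝ → EuclideanSpace ℝ (Fin n)} (hr : IsSolution A r)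
    {l : ℝ} (hl : 0 < l) {w : EuclideanSpace ℝ (Fin n)}
    (hw : ∀ x, inner ℝ w (Matrix.toEuclideanCLM (n := Fin n) (𝕜 := ℝ) A x) = l * inner ℝ w x)
    (h0 : inner ℝ w (r 0) ≠ 0) : Tendsto (fun t => ‖deriv r t‖) atTop atTop := by
  have hw0 : 0 < ‖w‖ := norm_pos_iff.2 fun h => h0 (by simp [h])
  have hf : ∀ t, HasDerivAt (fun t => inner ℝ w (r t)) (l * inner ℝ w (r t)) t := by
    intro t
    have h := (hasDerivAt_const t w).inner ℝ (hr t)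
    simpa [hw] using h
  have hsol : ∀ t, inner ℝ w (r t) = Real.exp (l * t) * inner ℝ w (r 0) := by
    have hc : ∀ t, HasDerivAt (fun t => Real.exp (-l * t) * inner ℝ w (r t)) 0 t := by
      intro t
      have he : HasDerivAt (fun s : ℝ => Real.exp (-l * s)) (Real.exp (-l * t) * -l) t := by
        simpa using ((hasDerivAt_id t).const_mul (-l)).exp
      exact (he.mul (hf t)).congr_deriv (by ring)
    intro t
    have := is_const_of_deriv_eq_zero (fun t => (hc t).differentiableAt)
      (fun t => (hc t).deriv) t 0
    simp only [mul_zero, Real.exp_zero, one_mul] at this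
    rw [← this, ← mul_assoc, ← Real.exp_add]
    simp
  have hlim : Tendsto (fun t => Real.exp (l * t) * (l * |inner ℝ w (r 0)| / ‖w‖)) atTop atTop :=
    (Real.tendsto_exp_atTop.comp (tendsto_id.const_mul_atTop hl)).atTop_mul_const (by positivity)
  refine tendsto_atTop_mono (fun t => ?_) hlim
  have h1 := abs_real_inner_le_norm w (deriv r t)
  rw [(hr t).deriv, hw, hsol, abs_mul, abs_mul, Real.abs_exp, abs_of_pos hl] at h1
  rw [(hr t).deriv, ← mul_div_assoc, div_le_iff₀ hw0]
  linarith

theorem volume_inner_eq_zero {w : EuclideanSpace ℝ (Fin n)} (hw : w ≠ 0) :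
    volume {x : EuclideanSpace ℝ (Fin n) | inner ℝ w x = 0} = 0 := by
  have h : LinearMap.ker (innerSL ℝ w).toLinearMap ≠ ⊤ := by
    intro h
    have : w ∈ LinearMap.ker (innerSL ℝ w).toLinearMap := h ▸ Submodule.mem_top
    simp [hw] at this
  exact Measure.addHaar_submodule volume _ h

end Matrix

end LTISystem

/-- `NullMeasurableSet E volume` says that `E` is Lebesgue measurable. -/
theorem proposition5p5 (n : ℕ) (A : Matrix (Fin n) (Fin n) ℝ) (hA : IsUnit A)
    (hreal : LTISystem.HasOnlyRealEigenvalues A)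
    (hE : ∃ E : Set (EuclideanSpace ℝ (Fin n)),
      NullMeasurableSet E volume ∧ 0 < volume E ∧
      ∀ r : ℝ → EuclideanSpace ℝ (Fin n), LTISystem.IsSolution A r → r 0 ∈ E →
        ((∃ L : ℝ, L ≠ 0 ∧ Tendsto (LTISystem.firstCurvature r) atTop (𝓝 L)) ∨
          ¬ ∃ L : ℝ, Tendsto (LTISystem.firstCurvature r) atTop (𝓝 L))) :
    LTISystem.IsAsymptoticallyStable A := by
  obtain ⟨E, -, hpos, hcurv⟩ := hE
  refine LTISystem.isAsymptoticallyStable_of_roots_neg hreal.splits_charpoly fun l hl => ?_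
  have hroot := Polynomial.isRoot_of_mem_roots hl
  obtain ⟨w, hw, hwA⟩ := LTISystem.exists_left_eigenvector hroot
  by_contra hneg
  have hl0 : l ≠ 0 := by
    rintro rfl
    refine spectrum.zero_notMem ℝ hA ?_
    exact Matrix.mem_spectrum_of_isRoot_charpoly hroot
  have hlpos : 0 < l := lt_of_le_of_ne (not_lt.1 hneg) hl0.symm
  obtain ⟨x, hxE, hx⟩ : ∃ x ∈ E, inner ℝ w x ≠ 0 := by
    by_contra! h
    exact hpos.ne' (measure_mono_null h (LTISystem.volume_inner_eq_zero hw))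
  obtain ⟨r, hr, rfl⟩ := LTISystem.exists_isSolution A x
  have hlim := hr.tendsto_firstCurvature_zero (hr.tendsto_norm_deriv hlpos hwA hx)
  -- A limit `+∞` falls under the second alternative, as `L` is real.
  rcases hcurv r hr hxE with ⟨L, hL, hL'⟩ | h
  · exact hL (tendsto_nhds_unique hL' hlim)
  · exact h ⟨0, hlim⟩
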